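/- A lattice polytope $P \subset \mathbb{R}^d$ is a convex polytope (the convex hull of a nonempty finite set) all of whose vertices lie in $\mathbb{Z}^d$. It is called normal if for every $N = 1, 2, \ldots$ and every $a \in NP \cap \mathbb{Z}^d$, where $NP = \{Nx : x \in P\}$, there exist $a_1, \ldots, a_N \in P \cap \mathbb{Z}^d$ with $a = a_1 + \cdots + a_N$; it is called very ample if this holds for all sufficiently large $N$. The lattice pyramid $\mathrm{pyr}(P) \subset \mathbb{R}^{d+1}$ is the convex hull of $\{(a,0) : a \in P\} \cup \{(0,\ldots,0,1)\}$. Proposition. Let $P \subset \mathbb{R}^d$ be a lattice polytope of dimension $d$. Then the following conditions are equivalent: (i) $P$ is normal; (ii) $\mathrm{pyr}(P)$ is normal; (iii) $\mathrm{pyr}(P)$ is very ample. -/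

import Mathlib

open scoped Pointwise

/-- The point of `ℝ^d` given by an integer vector. -/
def latticePoint {d : ℕ} (a : Fin d → ℤ) : Fin d → ℝ := fun i => (a i : ℝ)

/-- A convex polytope in `ℝ^d`: the convex hull of a nonempty finite set of points. -/
def IsConvexPolytope {d : ℕ} (P : Set (Fin d → ℝ)) : Prop :=
  ∃ S : Set (Fin d → ℝ), S.Finite ∧ S.Nonempty ∧ P = convexHull ℝ S

/-- A lattice polytope: a convex polytope each of whose vertices (that is, extreme points)
belongs to `ℤ^d`. -/
def IsLatticePolytope {d : ℕ} (P : Set (Fin d → ℝ)) : Prop :=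
  IsConvexPolytope P ∧ ∀ v ∈ P.extremePoints ℝ, ∃ a : Fin d → ℤ, v = latticePoint a

/-- The dimension of a polytope: the dimension of the affine subspace it spans. -/
noncomputable def polytopeDim {d : ℕ} (P : Set (Fin d → ℝ)) : ℕ :=
  Module.finrank ℝ (vectorSpan ℝ P)

/-- Every lattice point of the dilation `N P` is a sum of `N` lattice points of `P`. -/
def DecomposesAt {d : ℕ} (P : Set (Fin d → ℝ)) (N : ℕ) : Prop :=
  ∀ a : Fin d → ℤ, latticePoint a ∈ (N : ℝ) • P →
    ∃ b : Fin N → Fin d → ℤ, (∀ i, latticePoint (b i) ∈ P) ∧ a = ∑ i, b i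

/-- A normal lattice polytope. -/
def IsNormalPolytope {d : ℕ} (P : Set (Fin d → ℝ)) : Prop :=
  IsLatticePolytope P ∧ ∀ N : ℕ, 1 ≤ N → DecomposesAt P N

/-- A very ample lattice polytope: the decomposition property holds for all `N ≫ 0`. -/
def IsVeryAmplePolytope {d : ℕ} (P : Set (Fin d → ℝ)) : Prop :=
  IsLatticePolytope P ∧ ∃ N₀ : ℕ, ∀ N : ℕ, N₀ ≤ N → DecomposesAt P N

/-- The lattice pyramid over `P`: the convex hull in `ℝ^(d+1)` of the points `(a, 0)` with
`a ∈ P` together with the apex `(0, …, 0, 1)`. -/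
def latticePyramid {d : ℕ} (P : Set (Fin d → ℝ)) : Set (Fin (d + 1) → ℝ) :=
  convexHull ℝ ((fun a : Fin d → ℝ => (Fin.snoc a 0 : Fin (d + 1) → ℝ)) '' P ∪
    {(Fin.snoc (0 : Fin d → ℝ) 1 : Fin (d + 1) → ℝ)})

/-! The slice of `N • latticePyramid P` at height `s` is `(N - s) • P` (`mem_smul_latticePyramid`),
and the only lattice points of the pyramid are those of `P`, at height 0, and the apex, at height 1.
So decomposing `(a, n)` in the `(n + k)`-th dilation means using exactly `n` apexes and writing `a`
as a sum of `k` lattice points of `P`. Since `n` is free, any single `k` is reached from arbitrarily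
large dilations: very ampleness of the pyramid already forces normality of `P`. -/

theorem IsConvexPolytope.convex {d : ℕ} {P : Set (Fin d → ℝ)} (hP : IsConvexPolytope P) :
    Convex ℝ P := by
  obtain ⟨S, -, -, rfl⟩ := hP
  exact convex_convexHull ℝ S

theorem IsConvexPolytope.nonempty {d : ℕ} {P : Set (Fin d → ℝ)} (hP : IsConvexPolytope P) :
    P.Nonempty := by
  obtain ⟨S, -, hS, rfl⟩ := hP
  exact hS.convexHull

/-- The inclusion of `ℝ^d` in `ℝ^(d+1)` as the hyperplane of last coordinate `0`. -/
def snocZero (d : ℕ) : (Fin d → ℝ) →ₗ[ℝ] (Fin (d + 1) → ℝ) where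
  toFun a := Fin.snoc a 0
  map_add' a b := by
    ext i
    refine Fin.lastCases ?_ (fun j => ?_) i <;> simp
  map_smul' c a := by
    ext i
    refine Fin.lastCases ?_ (fun j => ?_) i <;> simp

theorem latticePyramid_eq {d : ℕ} (P : Set (Fin d → ℝ)) :
    latticePyramid P = convexHull ℝ (insert (Fin.snoc (0 : Fin d → ℝ) 1) (snocZero d '' P)) := by
  rw [latticePyramid, Set.union_singleton]
  rfl

theorem snoc_smul_add {d : ℕ} (p : Fin d → ℝ) (s t : ℝ) :
    t • (Fin.snoc (0 : Fin d → ℝ) 1 : Fin (d + 1) → ℝ) + s • snocZero d p =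
      Fin.snoc (s • p) t := by
  ext i
  refine Fin.lastCases ?_ (fun j => ?_) i <;> simp [snocZero]

theorem mem_latticePyramid {d : ℕ} {P : Set (Fin d → ℝ)} (hc : Convex ℝ P) (hne : P.Nonempty)
    {y : Fin (d + 1) → ℝ} :
    y ∈ latticePyramid P ↔
      ∃ p ∈ P, ∃ t : ℝ, 0 ≤ t ∧ t ≤ 1 ∧ y = Fin.snoc ((1 - t) • p) t := by
  rw [latticePyramid_eq, convexHull_insert (hne.image _), (hc.linear_image _).convexHull_eq]
  simp only [convexJoin_singleton_left, Set.mem_iUnion, Set.exists_mem_image, exists_prop]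
  refine exists_congr fun p => and_congr_right fun _ => ?_
  constructor
  · rintro ⟨t, s, ht, hs, hts, rfl⟩
    exact ⟨t, ht, by linarith, by rw [snoc_smul_add, ← hts, add_sub_cancel_left]⟩
  · rintro ⟨t, ht, ht', rfl⟩
    exact ⟨t, 1 - t, ht, by linarith, by ring, snoc_smul_add _ _ _⟩

theorem mem_smul_latticePyramid {d : ℕ} {P : Set (Fin d → ℝ)} (hc : Convex ℝ P)
    (hne : P.Nonempty) {c : ℝ} (hc₀ : 0 ≤ c) {y : Fin (d + 1) → ℝ} :
    y ∈ c • latticePyramid P ↔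
      ∃ p ∈ P, ∃ s : ℝ, 0 ≤ s ∧ s ≤ c ∧ y = Fin.snoc ((c - s) • p) s := by
  have smul_snoc : ∀ (p : Fin d → ℝ) (t : ℝ),
      c • (Fin.snoc ((1 - t) • p) t : Fin (d + 1) → ℝ) = Fin.snoc ((c - c * t) • p) (c * t) := by
    intro p t
    ext i
    refine Fin.lastCases ?_ (fun j => ?_) i
    · simp
    · simp
      ring
  rw [Set.mem_smul_set]
  constructor
  · rintro ⟨x, hx, rfl⟩
    obtain ⟨p, hp, t, ht, ht', rfl⟩ := (mem_latticePyramid hc hne).1 hx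
    exact ⟨p, hp, c * t, by positivity, mul_le_of_le_one_right hc₀ ht', smul_snoc p t⟩
  · rintro ⟨p, hp, s, hs, hs', rfl⟩
    -- For `c = 0` the bounds force `s = 0`, so the junk value of `s / 0` is harmless.
    have hcs : c * (s / c) = s := by
      rcases hc₀.eq_or_lt with rfl | h
      · rw [zero_mul, le_antisymm hs' hs]
      · field_simp
    exact ⟨_, (mem_latticePyramid hc hne).2
      ⟨p, hp, s / c, by positivity, div_le_one_of_le₀ hs' hc₀, rfl⟩, by rw [smul_snoc, hcs]⟩

theorem latticePoint_snoc {d : ℕ} (a : Fin d → ℤ) (n : ℤ) :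
    latticePoint (Fin.snoc a n : Fin (d + 1) → ℤ) = Fin.snoc (latticePoint a) (n : ℝ) := by
  ext i
  refine Fin.lastCases ?_ (fun j => ?_) i <;> simp [latticePoint]

theorem latticePoint_zero {d : ℕ} : latticePoint (0 : Fin d → ℤ) = 0 := by
  ext i
  simp [latticePoint]

theorem snocZero_mem_latticePyramid {d : ℕ} {P : Set (Fin d → ℝ)} {p : Fin d → ℝ} (hp : p ∈ P) :
    snocZero d p ∈ latticePyramid P := by
  rw [latticePyramid_eq]
  exact subset_convexHull ℝ _ (Set.mem_insert_of_mem _ ⟨p, hp, rfl⟩)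

theorem apex_mem_latticePyramid {d : ℕ} (P : Set (Fin d → ℝ)) :
    (Fin.snoc (0 : Fin d → ℝ) 1 : Fin (d + 1) → ℝ) ∈ latticePyramid P := by
  rw [latticePyramid_eq]
  exact subset_convexHull ℝ _ (Set.mem_insert _ _)

theorem snocZero_injective (d : ℕ) : Function.Injective (snocZero d) := fun a b h => by
  ext i
  simpa [snocZero] using congrFun h i.castSucc

theorem IsConvexPolytope.latticePyramid {d : ℕ} {P : Set (Fin d → ℝ)}
    (hP : IsConvexPolytope P) : IsConvexPolytope (latticePyramid P) := by
  obtain ⟨S, hS, -, rfl⟩ := hP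
  refine ⟨insert (Fin.snoc (0 : Fin d → ℝ) 1) (snocZero d '' S), (hS.image _).insert _,
    Set.insert_nonempty _ _, ?_⟩
  rw [latticePyramid_eq, LinearMap.image_convexHull, Set.insert_eq, Set.insert_eq,
    convexHull_convexHull_union_right]

theorem IsLatticePolytope.latticePyramid {d : ℕ} {P : Set (Fin d → ℝ)}
    (hP : IsLatticePolytope P) : IsLatticePolytope (latticePyramid P) := by
  refine ⟨hP.1.latticePyramid, fun v hv => ?_⟩
  have hv' := hv
  rw [latticePyramid_eq] at hv'
  rcases extremePoints_convexHull_subset hv' with rfl | ⟨p, hp, rfl⟩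
  · exact ⟨Fin.snoc 0 1, by rw [latticePoint_snoc, latticePoint_zero, Int.cast_one]⟩
  · have hext : p ∈ P.extremePoints ℝ := by
      refine ⟨hp, fun x hx y hy hxy => snocZero_injective d ?_⟩
      refine hv.2 (snocZero_mem_latticePyramid hx) (snocZero_mem_latticePyramid hy) ?_
      exact image_openSegment ℝ (snocZero d).toAffineMap x y ▸ Set.mem_image_of_mem _ hxy
    obtain ⟨a, rfl⟩ := hP.2 p hext
    exact ⟨Fin.snoc a 0, by rw [latticePoint_snoc, Int.cast_zero]; rfl⟩

/-- Normality starts at `N = 1`, but a point at the top height of a dilated pyramid leaves `k = 0`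
summands from `P`. -/
theorem decomposesAt_zero {d : ℕ} (P : Set (Fin d → ℝ)) : DecomposesAt P 0 := by
  intro a ha
  obtain ⟨x, -, hx⟩ := Set.mem_smul_set.1 ha
  refine ⟨Fin.elim0, fun i => i.elim0, ?_⟩
  ext i
  simpa [latticePoint, eq_comm] using congrFun hx i

theorem decomposesAt_latticePyramid {d : ℕ} {P : Set (Fin d → ℝ)} (hc : Convex ℝ P)
    (hne : P.Nonempty) (h : ∀ k, DecomposesAt P k) (N : ℕ) :
    DecomposesAt (latticePyramid P) N := by
  intro a ha
  obtain ⟨a, n, rfl⟩ : ∃ (a' : Fin d → ℤ) (n : ℤ), a = Fin.snoc a' n :=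
    ⟨Fin.init a, a (Fin.last d), (Fin.snoc_init_self a).symm⟩
  obtain ⟨p, hp, s, hs, hsN, heq⟩ := (mem_smul_latticePyramid hc hne N.cast_nonneg).1 ha
  rw [latticePoint_snoc, Fin.snoc_inj] at heq
  obtain ⟨hap, rfl⟩ := heq
  lift n to ℕ using by exact_mod_cast hs
  obtain ⟨k, rfl⟩ : ∃ k, N = k + n :=
    ⟨N - n, (Nat.sub_add_cancel (by exact_mod_cast hsN)).symm⟩
  obtain ⟨b, hb, rfl⟩ := h k a (by
    rw [hap]
    exact Set.mem_smul_set.2 ⟨p, hp, by push_cast; rw [add_sub_cancel_right]⟩)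
  refine ⟨Fin.append (fun i => Fin.snoc (b i) 0) (fun _ => Fin.snoc 0 1), fun i => ?_, ?_⟩
  · refine Fin.addCases (fun j => ?_) (fun j => ?_) i
    · rw [Fin.append_left, latticePoint_snoc, Int.cast_zero]
      exact snocZero_mem_latticePyramid (hb j)
    · rw [Fin.append_right, latticePoint_snoc, latticePoint_zero, Int.cast_one]
      exact apex_mem_latticePyramid P
  · rw [Fin.sum_univ_add]
    ext i
    refine Fin.lastCases ?_ (fun j => ?_) i <;> simp

theorem eq_or_eq_of_latticePoint_mem_latticePyramid {d : ℕ} {P : Set (Fin d → ℝ)}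
    (hc : Convex ℝ P) (hne : P.Nonempty) {a : Fin (d + 1) → ℤ}
    (ha : latticePoint a ∈ latticePyramid P) :
    (latticePoint (Fin.init a : Fin d → ℤ) ∈ P ∧ a (Fin.last d) = 0) ∨
      ((Fin.init a : Fin d → ℤ) = 0 ∧ a (Fin.last d) = 1) := by
  obtain ⟨p, hp, t, ht, ht', heq⟩ := (mem_latticePyramid hc hne).1 ha
  rw [← Fin.snoc_init_self a, latticePoint_snoc, Fin.snoc_inj] at heq
  obtain ⟨hap, rfl⟩ := heq
  have h0 : 0 ≤ a (Fin.last d) := by exact_mod_cast ht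
  have h1 : a (Fin.last d) ≤ 1 := by exact_mod_cast ht'
  obtain h | h : a (Fin.last d) = 0 ∨ a (Fin.last d) = 1 := by omega
  · left
    refine ⟨?_, h⟩
    rw [hap, h, Int.cast_zero, sub_zero, one_smul]
    exact hp
  · right
    refine ⟨?_, h⟩
    rw [h, Int.cast_one, sub_self, zero_smul] at hap
    ext i
    simpa [latticePoint] using congrFun hap i

theorem DecomposesAt.of_latticePyramid {d : ℕ} {P : Set (Fin d → ℝ)} (hc : Convex ℝ P)
    (hne : P.Nonempty) {n k : ℕ} (h : DecomposesAt (latticePyramid P) (n + k)) :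
    DecomposesAt P k := by
  classical
  intro a ha
  obtain ⟨p, hp, hap⟩ := Set.mem_smul_set.1 ha
  obtain ⟨b, hb, hsum⟩ := h (Fin.snoc a n) ((mem_smul_latticePyramid hc hne
    (Nat.cast_nonneg _)).2 ⟨p, hp, n, n.cast_nonneg, by push_cast; simp, by
      rw [latticePoint_snoc, ← hap]
      push_cast
      rw [add_sub_cancel_left]⟩)
  have hb' := fun i => eq_or_eq_of_latticePoint_mem_latticePyramid hc hne (hb i)
  let T := Finset.univ.filter fun i => b i (Fin.last d) = 0
  have hlast : (n : ℤ) = ∑ i, b i (Fin.last d) := by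
    simpa using congrFun hsum (Fin.last d)
  have hT : T.card = k := by
    -- Heights are 0 or 1, so `1 - height` is the indicator of `T`; the total is `(n + k) - n`.
    have h1 : ∑ i, (1 - b i (Fin.last d)) = (T.card : ℤ) := by
      rw [Finset.card_filter, Nat.cast_sum]
      refine Finset.sum_congr rfl fun i _ => ?_
      rcases hb' i with ⟨-, hi⟩ | ⟨-, hi⟩ <;> simp [hi]
    rw [Finset.sum_sub_distrib, ← hlast] at h1
    simp at h1
    omega
  let e : Fin k ≃ T := (T.equivFinOfCardEq hT).symm
  refine ⟨fun i => Fin.init (b (e i)), fun i => ?_, ?_⟩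
  · have hi : b (e i) (Fin.last d) = 0 := (Finset.mem_filter.1 (e i).2).2
    rcases hb' (e i) with ⟨hm, -⟩ | ⟨-, hi'⟩
    · exact hm
    · omega
  -- Summands outside `T` are apexes, which add nothing to the first `d` coordinates.
  · rw [e.sum_comp (fun i : T => (Fin.init (b i) : Fin d → ℤ)),
      Finset.sum_coe_sort T (fun i => (Fin.init (b i) : Fin d → ℤ)),
      Finset.sum_subset (Finset.subset_univ T)]
    · ext j
      simpa [Fin.init] using congrFun hsum j.castSucc
    · intro i _ hi
      rcases hb' i with ⟨-, hi'⟩ | ⟨h0, -⟩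
      · exact absurd (Finset.mem_filter.2 ⟨Finset.mem_univ i, hi'⟩) hi
      · exact h0

/-- A `d`-dimensional lattice polytope in `ℝ^d` is normal iff its lattice pyramid is normal iff
its lattice pyramid is very ample. -/
theorem mainTheorem7 (d : ℕ) (P : Set (Fin d → ℝ)) (hP : IsLatticePolytope P)
    (hdim : polytopeDim P = d) :
    List.TFAE [IsNormalPolytope P,
      IsNormalPolytope (latticePyramid P),
      IsVeryAmplePolytope (latticePyramid P)] := by
  have hc := hP.1.convex
  have hne := hP.1.nonempty
  tfae_have 1 → 2 := fun h => ⟨hP.latticePyramid, fun N _ =>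
    decomposesAt_latticePyramid hc hne (fun k => by
      rcases k.eq_zero_or_pos with rfl | hk
      · exact decomposesAt_zero P
      · exact h.2 k hk) N⟩
  tfae_have 2 → 3 := fun h => ⟨h.1, 1, h.2⟩
  tfae_have 3 → 1 := fun ⟨_, n, h⟩ => ⟨hP, fun k _ =>
    DecomposesAt.of_latticePyramid hc hne (h (n + k) (Nat.le_add_right n k))⟩
  tfae_finish
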